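/- Let $C([0,\infty])$ be the Banach space of continuous (real- or complex-valued) functions on $[0,\infty[$ that converge at infinity, endowed with the sup-norm $\|\cdot\|_\infty$. For $\gamma>0$ and $b\ge 0$ let $A^{\gamma,b}u(x)=\gamma x u''(x)+bu'(x)$ (extended to $x=0$ by continuity) with domain $$D(A^{\gamma,0})=\{u\in C([0,\infty])\cap C^2(]0,\infty[) : \lim_{x\to0^+}A^{\gamma,0}u(x)=0,\ \lim_{x\to\infty}A^{\gamma,0}u(x)=0\},$$ $$D(A^{\gamma,b})=\{u\in C^1([0,\infty[)\cap C^2(]0,\infty[)\cap C([0,\infty]) : \lim_{x\to0^+}xu''(x)=0,\ \lim_{x\to\infty}A^{\gamma,b}u(x)=0\}\quad (b>0).$$ For $x,y\ge 0$ and $t>0$ let $$p^{\gamma,b}(x,y,t)=(\gamma t)^{-\frac b\gamma}e^{-\frac{x+y}{\gamma t}}y^{\frac b\gamma-1}\sum_{m=0}^\infty\frac{1}{m!\,\Gamma(m+\frac b\gamma)}\frac{x^my^m}{\gamma^{2m}t^{2m}}\quad(b>0),$$ $$p^{\gamma,0}(x,y,t)=e^{-\frac{x}{\gamma t}}\delta_0(y)+(\gamma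 t)^{-1}e^{-\frac{x+y}{\gamma t}}\sum_{m=0}^\infty\frac{1}{(m+1)!\,m!}\frac{x^{m+1}y^m}{\gamma^{2m+1}t^{2m+1}},$$ where $\delta_0$ is the point mass at $0$, and let $P_t^{\gamma,b}f(x)=\int_0^\infty p^{\gamma,b}(x,y,t)f(y)\,dy$ for $t>0$ and $P_0^{\gamma,b}=I$. **Proposition.** Let $B,\gamma_0>0$. Then, for every $b\in[0,B]$, $\gamma\ge\gamma_0$ and $f\in C([0,\infty])$, one has $P_t^{\gamma,b}f\in D(A^{\gamma,b})$ for every $t>0$, and $$\|tA^{\gamma,b}P_t^{\gamma,b}f\|_\infty\le 2\Bigl(1+\sqrt2+\frac b\gamma\Bigr)\|f\|_\infty\le 2\Bigl(1+\sqrt2+\frac B{\gamma_0}\Bigr)\|f\|_\infty,\qquad t\ge 0,$$ where for $t=0$ the first inequality is asserted for $f\in D(A^{\gamma,b})$. In particular the constant is uniform for $b$ in the bounded interval $[0,B]$ and $\gamma$ in the half-line $[\gamma_0,\infty[$. -/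

import Mathlib

open Set Filter Topology MeasureTheory
open scoped NNReal BoundedContinuousFunction

noncomputable section

namespace DegDiff

variable {𝕜 : Type*} [RCLike 𝕜]

/-- The Banach space `C([0,∞])` of continuous functions on `[0,∞[` that converge at infinity,
with the sup-norm (inherited from the bounded continuous functions). -/
def CInfty (𝕜 : Type*) [RCLike 𝕜] : Submodule 𝕜 (ℝ≥0 →ᵇ 𝕜) where
  carrier := {f | ∃ l : 𝕜, Tendsto f atTop (𝓝 l)}
  add_mem' := by
    rintro f g ⟨l, hl⟩ ⟨m, hm⟩
    exact ⟨l + m, hl.add hm⟩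
  zero_mem' := ⟨0, tendsto_const_nhds⟩
  smul_mem' := by
    rintro c f ⟨l, hl⟩
    exact ⟨c • l, hl.const_smul c⟩

/-- A function on `[0,∞[`, regarded as a function on the line (only its values and its one-sided
derivatives on `[0,∞[` are ever used). -/
def toLine (u : ℝ≥0 → 𝕜) : ℝ → 𝕜 := fun x => u x.toNNReal

/-- `u'` on `[0,∞[` (the right derivative at `0`). -/
def D1 (u : ℝ≥0 → 𝕜) : ℝ → 𝕜 := derivWithin (toLine u) (Ici 0)

/-- `u''` on `[0,∞[`. -/
def D2 (u : ℝ≥0 → 𝕜) : ℝ → 𝕜 := derivWithin (D1 u) (Ici 0)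

/-- The differential expression `γ x u''(x) + b u'(x)`. -/
def diffExpr (γ b : ℝ) (u : ℝ≥0 → 𝕜) (x : ℝ) : 𝕜 := (γ * x) • D2 u x + b • D1 u x

/-- Membership in the domain of `A^{γ,b}`:
* for `b = 0`: `u ∈ C([0,∞]) ∩ C²(]0,∞[)` with `A u(x) → 0` as `x → 0⁺` and as `x → ∞`;
* for `b > 0`: `u ∈ C¹([0,∞[) ∩ C²(]0,∞[) ∩ C([0,∞])` with `x u''(x) → 0` as `x → 0⁺`
  and `A u(x) → 0` as `x → ∞`. -/
structure InDomain (γ b : ℝ) (u : ℝ≥0 → 𝕜) : Prop where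
  contDiffOn_two : ContDiffOn ℝ 2 (toLine u) (Ioi 0)
  tendsto_atTop : Tendsto (diffExpr γ b u) atTop (𝓝 0)
  tendsto_zero : b = 0 → Tendsto (diffExpr γ b u) (𝓝[>] 0) (𝓝 0)
  contDiffOn_one : b ≠ 0 → ContDiffOn ℝ 1 (toLine u) (Ici 0)
  tendsto_mul_D2 : b ≠ 0 → Tendsto (fun x : ℝ => x • D2 u x) (𝓝[>] 0) (𝓝 0)

section helpers

theorem toLine_add (u v : ℝ≥0 → 𝕜) : toLine (u + v) = toLine u + toLine v := rfl

theorem toLine_smul (c : 𝕜) (u : ℝ≥0 → 𝕜) : toLine (c • u) = c • toLine u := rfl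

theorem D1_eq_deriv (u : ℝ≥0 → 𝕜) {x : ℝ} (hx : 0 < x) : D1 u x = deriv (toLine u) x :=
  derivWithin_of_mem_nhds (Ici_mem_nhds hx)

theorem D1_eventuallyEq (u : ℝ≥0 → 𝕜) {x : ℝ} (hx : 0 < x) :
    D1 u =ᶠ[𝓝 x] deriv (toLine u) := by
  filter_upwards [Ioi_mem_nhds hx] with y hy using D1_eq_deriv u hy

theorem D2_eq_deriv (u : ℝ≥0 → 𝕜) {x : ℝ} (hx : 0 < x) :
    D2 u x = deriv (deriv (toLine u)) x :=
  (derivWithin_of_mem_nhds (Ici_mem_nhds hx)).trans (D1_eventuallyEq u hx).deriv_eq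

variable {u v : ℝ≥0 → 𝕜}

theorem differentiableAt_of_c2 (hu : ContDiffOn ℝ 2 (toLine u) (Ioi 0)) {x : ℝ} (hx : 0 < x) :
    DifferentiableAt ℝ (toLine u) x :=
  (hu.contDiffAt (Ioi_mem_nhds hx)).differentiableAt (by norm_num)

theorem contDiffOn_deriv (hu : ContDiffOn ℝ 2 (toLine u) (Ioi 0)) :
    ContDiffOn ℝ 1 (deriv (toLine u)) (Ioi 0) :=
  hu.deriv_of_isOpen isOpen_Ioi (by norm_num)

theorem differentiableAt_deriv (hu : ContDiffOn ℝ 2 (toLine u) (Ioi 0)) {x : ℝ} (hx : 0 < x) :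
    DifferentiableAt ℝ (deriv (toLine u)) x :=
  ((contDiffOn_deriv hu).contDiffAt (Ioi_mem_nhds hx)).differentiableAt (by norm_num)

theorem D1_add_of_pos (hu : ContDiffOn ℝ 2 (toLine u) (Ioi 0))
    (hv : ContDiffOn ℝ 2 (toLine v) (Ioi 0)) {x : ℝ} (hx : 0 < x) :
    D1 (u + v) x = D1 u x + D1 v x := by
  rw [D1_eq_deriv _ hx, D1_eq_deriv _ hx, D1_eq_deriv _ hx, toLine_add,
    deriv_add (differentiableAt_of_c2 hu hx) (differentiableAt_of_c2 hv hx)]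

theorem D2_add_of_pos (hu : ContDiffOn ℝ 2 (toLine u) (Ioi 0))
    (hv : ContDiffOn ℝ 2 (toLine v) (Ioi 0)) {x : ℝ} (hx : 0 < x) :
    D2 (u + v) x = D2 u x + D2 v x := by
  rw [D2_eq_deriv _ hx, D2_eq_deriv _ hx, D2_eq_deriv _ hx,
    ← deriv_add (differentiableAt_deriv hu hx) (differentiableAt_deriv hv hx)]
  apply Filter.EventuallyEq.deriv_eq
  filter_upwards [Ioi_mem_nhds hx] with y hy
  rw [toLine_add, deriv_add (differentiableAt_of_c2 hu hy) (differentiableAt_of_c2 hv hy)]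
  rfl

theorem D1_smul (c : 𝕜) (u : ℝ≥0 → 𝕜) : D1 (c • u) = c • D1 u := by
  funext x
  simp only [D1, toLine_smul, Pi.smul_apply]
  exact derivWithin_const_smul_field c (toLine u)

theorem D2_smul (c : 𝕜) (u : ℝ≥0 → 𝕜) : D2 (c • u) = c • D2 u := by
  funext x
  simp only [D2, D1_smul, Pi.smul_apply]
  exact derivWithin_const_smul_field c (D1 u)

theorem diffExpr_smul (γ b : ℝ) (c : 𝕜) (u : ℝ≥0 → 𝕜) :
    diffExpr γ b (c • u) = c • diffExpr γ b u := by
  funext x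
  simp only [diffExpr, D1_smul, D2_smul, Pi.smul_apply, smul_add]
  rw [smul_comm c, smul_comm c]

theorem diffExpr_add {γ b : ℝ} (hu : InDomain γ b u) (hv : InDomain γ b v) {x : ℝ} (hx : 0 ≤ x) :
    diffExpr γ b (u + v) x = diffExpr γ b u x + diffExpr γ b v x := by
  simp only [diffExpr]
  rcases hx.eq_or_lt with rfl | hx
  · by_cases hb : b = 0
    · simp [hb]
    · have h1 : D1 (u + v) 0 = D1 u 0 + D1 v 0 := by
        simp only [D1, toLine_add]
        exact derivWithin_add
          ((hu.contDiffOn_one hb).differentiableOn (by norm_num) 0 self_mem_Ici)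
          ((hv.contDiffOn_one hb).differentiableOn (by norm_num) 0 self_mem_Ici)
      simp [h1]
  · rw [D1_add_of_pos hu.contDiffOn_two hv.contDiffOn_two hx,
      D2_add_of_pos hu.contDiffOn_two hv.contDiffOn_two hx]
    simp only [smul_add]
    abel

theorem InDomain.add {γ b : ℝ} (hu : InDomain γ b u) (hv : InDomain γ b v) :
    InDomain γ b (u + v) where
  contDiffOn_two := hu.contDiffOn_two.add hv.contDiffOn_two
  tendsto_atTop := by
    have h := hu.tendsto_atTop.add hv.tendsto_atTop
    rw [add_zero] at h
    refine h.congr' ?_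
    filter_upwards [eventually_ge_atTop 0] with x hx using (diffExpr_add hu hv hx).symm
  tendsto_zero hb := by
    have h := (hu.tendsto_zero hb).add (hv.tendsto_zero hb)
    rw [add_zero] at h
    refine h.congr' ?_
    filter_upwards [self_mem_nhdsWithin] with x hx using
      (diffExpr_add hu hv (le_of_lt hx)).symm
  contDiffOn_one hb := (hu.contDiffOn_one hb).add (hv.contDiffOn_one hb)
  tendsto_mul_D2 hb := by
    have h := (hu.tendsto_mul_D2 hb).add (hv.tendsto_mul_D2 hb)
    rw [add_zero] at h
    refine h.congr' ?_
    filter_upwards [self_mem_nhdsWithin] with x hx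
    rw [D2_add_of_pos hu.contDiffOn_two hv.contDiffOn_two hx, smul_add]

theorem InDomain.smul {γ b : ℝ} (c : 𝕜) (hu : InDomain γ b u) : InDomain γ b (c • u) where
  contDiffOn_two := hu.contDiffOn_two.const_smul c
  tendsto_atTop := by
    have h := hu.tendsto_atTop.const_smul c
    rw [smul_zero] at h
    rw [diffExpr_smul]
    exact h
  tendsto_zero hb := by
    have h := (hu.tendsto_zero hb).const_smul c
    rw [smul_zero] at h
    rw [diffExpr_smul]
    exact h
  contDiffOn_one hb := (hu.contDiffOn_one hb).const_smul c
  tendsto_mul_D2 hb := by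
    have h := (hu.tendsto_mul_D2 hb).const_smul c
    rw [smul_zero] at h
    refine h.congr fun x => ?_
    rw [D2_smul, Pi.smul_apply, smul_comm]

theorem InDomain.zero (γ b : ℝ) : InDomain γ b (0 : ℝ≥0 → 𝕜) := by
  have h0 : toLine (0 : ℝ≥0 → 𝕜) = fun _ => 0 := rfl
  have h1 : D1 (0 : ℝ≥0 → 𝕜) = fun _ => 0 := by funext x; simp [D1, h0]
  have h2 : D2 (0 : ℝ≥0 → 𝕜) = fun _ => 0 := by funext x; simp [D2, h1]
  have h3 : diffExpr γ b (0 : ℝ≥0 → 𝕜) = fun _ => 0 := by funext x; simp [diffExpr, h1, h2]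
  refine ⟨?_, ?_, fun _ => ?_, fun _ => ?_, fun _ => ?_⟩
  · rw [h0]; exact contDiffOn_const
  · rw [h3]; exact tendsto_const_nhds
  · rw [h3]; exact tendsto_const_nhds
  · rw [h0]; exact contDiffOn_const
  · simp [h2]

theorem InDomain.continuousOn {γ b : ℝ} (hu : InDomain γ b u) :
    ContinuousOn (diffExpr γ b u) (Ici 0) := by
  intro x hx
  rcases (mem_Ici.1 hx).eq_or_lt with rfl | hx
  · have key : Tendsto (diffExpr γ b u) (𝓝[>] 0) (𝓝 (diffExpr γ b u 0)) := by
      by_cases hb : b = 0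
      · have h := hu.tendsto_zero hb
        have h0 : diffExpr γ b u 0 = 0 := by simp [diffExpr, hb]
        rwa [h0]
      · have h1 : ContinuousOn (D1 u) (Ici 0) :=
          (hu.contDiffOn_one hb).continuousOn_derivWithin (uniqueDiffOn_Ici 0) le_rfl
        have h2 : Tendsto (D1 u) (𝓝[>] 0) (𝓝 (D1 u 0)) :=
          (h1 0 self_mem_Ici).mono_left (nhdsWithin_mono _ Ioi_subset_Ici_self)
        have h3 := ((hu.tendsto_mul_D2 hb).const_smul γ).add (h2.const_smul b)
        have h0 : diffExpr γ b u 0 = γ • (0 : 𝕜) + b • D1 u 0 := by simp [diffExpr]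
        rw [h0]
        refine h3.congr fun x => ?_
        simp only [diffExpr, mul_smul]
    have h : ContinuousWithinAt (diffExpr γ b u) (Ioi 0) 0 := key
    exact continuousWithinAt_Ioi_iff_Ici.1 h
  · apply ContinuousAt.continuousWithinAt
    have h1 : ContinuousAt (D1 u) x :=
      (differentiableAt_deriv hu.contDiffOn_two hx).continuousAt.congr (D1_eventuallyEq u hx).symm
    have h2 : ContinuousAt (D2 u) x := by
      have h3 : ContinuousOn (deriv (deriv (toLine u))) (Ioi 0) :=
        (contDiffOn_deriv hu.contDiffOn_two).continuousOn_deriv_of_isOpen isOpen_Ioi le_rfl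
      refine (h3.continuousAt (Ioi_mem_nhds hx)).congr ?_
      filter_upwards [Ioi_mem_nhds hx] with y hy using (D2_eq_deriv u hy).symm
    exact ((continuousAt_const.mul continuousAt_id).smul h2).add (continuousAt_const.smul h1)

theorem exists_bound {g : ℝ≥0 → 𝕜} (hg : Continuous g) {l : 𝕜} (hl : Tendsto g atTop (𝓝 l)) :
    ∃ C, ∀ x, ‖g x‖ ≤ C := by
  have h1 : ∀ᶠ x in atTop, ‖g x‖ < ‖l‖ + 1 := hl.norm.eventually_lt_const (lt_add_one _)
  obtain ⟨N, hN⟩ := eventually_atTop.1 h1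
  obtain ⟨C, hC⟩ := isCompact_Icc.exists_bound_of_continuousOn (s := Icc 0 N) hg.continuousOn
  refine ⟨max C (‖l‖ + 1), fun x => ?_⟩
  rcases le_total x N with h | h
  · exact (hC x ⟨zero_le, h⟩).trans (le_max_left _ _)
  · exact (hN x h).le.trans (le_max_right _ _)

theorem InDomain.continuous {γ b : ℝ} (hu : InDomain γ b u) :
    Continuous fun x : ℝ≥0 => diffExpr γ b u x :=
  hu.continuousOn.comp_continuous NNReal.continuous_coe fun x => x.2

theorem InDomain.tendsto {γ b : ℝ} (hu : InDomain γ b u) :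
    Tendsto (fun x : ℝ≥0 => diffExpr γ b u x) atTop (𝓝 0) :=
  hu.tendsto_atTop.comp (NNReal.tendsto_coe_atTop.2 tendsto_id)

end helpers

/-- The domain `D(A^{γ,b})` as a subspace of `C([0,∞])`. -/
def domain (𝕜 : Type*) [RCLike 𝕜] (γ b : ℝ) : Submodule 𝕜 (CInfty 𝕜) where
  carrier := {u | InDomain γ b (u : ℝ≥0 →ᵇ 𝕜)}
  add_mem' hu hv := hu.add hv
  zero_mem' := InDomain.zero γ b
  smul_mem' c _ hu := hu.smul c

/-- The function `x ↦ γ x u''(x) + b u'(x)` as an element of `C([0,∞])`, for `u ∈ D(A^{γ,b})`. -/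
def genFun (γ b : ℝ) (u : domain 𝕜 γ b) : CInfty 𝕜 :=
  ⟨BoundedContinuousFunction.ofNormedAddCommGroup
    (fun x : ℝ≥0 => diffExpr γ b ((u : CInfty 𝕜) : ℝ≥0 →ᵇ 𝕜) x)
    (InDomain.continuous u.2) _
    (exists_bound (InDomain.continuous u.2) (InDomain.tendsto u.2)).choose_spec,
    0, InDomain.tendsto u.2⟩

/-- The unbounded operator `A^{γ,b} u(x) = γ x u''(x) + b u'(x)` in `C([0,∞])`
with domain `D(A^{γ,b})`. -/
def A (𝕜 : Type*) [RCLike 𝕜] (γ b : ℝ) : CInfty 𝕜 →ₗ.[𝕜] CInfty 𝕜 where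
  domain := domain 𝕜 γ b
  toFun :=
    { toFun := genFun γ b
      map_add' := fun u v => Subtype.ext <| BoundedContinuousFunction.ext fun x =>
        diffExpr_add u.2 v.2 x.2
      map_smul' := fun c u => Subtype.ext <| BoundedContinuousFunction.ext fun x =>
        congrFun (diffExpr_smul γ b c ((u : CInfty 𝕜) : ℝ≥0 →ᵇ 𝕜)) x }

/-- The kernel `p^{γ,b}(x,y,t)` for `b > 0`. -/
def kernelPos (γ b x y t : ℝ) : ℝ :=
  (γ * t) ^ (-(b / γ)) * Real.exp (-((x + y) / (γ * t))) * y ^ (b / γ - 1) *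
    ∑' m : ℕ, 1 / ((m.factorial : ℝ) * Real.Gamma (m + b / γ)) *
      (x ^ m * y ^ m / (γ ^ (2 * m) * t ^ (2 * m)))

/-- The density of the absolutely continuous part of the kernel `p^{γ,0}(x,·,t)`; its remaining
part is the point mass of weight `e^{-x/(γt)}` at `0`. -/
def kernelZero (γ x y t : ℝ) : ℝ :=
  (γ * t)⁻¹ * Real.exp (-((x + y) / (γ * t))) *
    ∑' m : ℕ, 1 / (((m + 1).factorial : ℝ) * (m.factorial : ℝ)) *
      (x ^ (m + 1) * y ^ m / (γ ^ (2 * m + 1) * t ^ (2 * m + 1)))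

/-- The measure `p^{γ,b}(x,y,t) dy` on `[0,∞[`, for `t > 0`. -/
def kernelMeasure (γ b t x : ℝ) : Measure ℝ :=
  if b = 0 then
    ENNReal.ofReal (Real.exp (-(x / (γ * t)))) • Measure.dirac 0 +
      (volume.restrict (Ioi 0)).withDensity fun y => ENNReal.ofReal (kernelZero γ x y t)
  else (volume.restrict (Ioi 0)).withDensity fun y => ENNReal.ofReal (kernelPos γ b x y t)

/-- `P_t^{γ,b} f(x) = ∫ p^{γ,b}(x,y,t) f(y) dy` for `t > 0`, and `P_0^{γ,b} = I`. -/
def P (γ b t : ℝ) (f : ℝ≥0 → 𝕜) (x : ℝ≥0) : 𝕜 :=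
  if t = 0 then f x else ∫ y, toLine f y ∂(kernelMeasure γ b t x)

end DegDiff

end

/-!
Put `s = γ t` and `β = b/γ`. Expanding the Bessel-type series of the kernel term by term shows that
`p^{γ,b}(x,·,t)` is a Poisson mixture: draw `m` from the Poisson law of mean `ξ = x/s`, then `y`
from the gamma law of shape `m + β` and scale `s`, where shape `0` (which occurs only if `b = 0`)
means the point mass at `0` (`kernelMeasure_eq_sum`). Hence `P_t f(x) = v(x/s)`, where
`v(ξ) = ∑ e^{-ξ} ξ^m/m! · a m` is the Poisson mean of the sequence `a m` of gamma means of `f`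
(`P_eq_poissonMean`). This sequence is bounded by `‖f‖` and converges to the limit of `f` at
infinity, as the gamma laws escape to infinity (`tendsto_gammaMean`).

The function `v` is smooth across `0`, and differentiating it amounts to taking forward differences
of `a` (`hasDerivAt_poissonMean`), which gives all conditions at `0`. In the variable `ξ`, the
operator `t A^{γ,b}` becomes `ξ v'' + β v'` (`smul_diffExpr_eq`). Here `|v'| ≤ 2 ‖f‖`, and summation
by parts gives `ξ v''(ξ) = ∑ e^{-ξ} ξ^m/m! · ((m - ξ)² - m)/ξ · a m` (`hasSum_secondWeight`), where
the weights have absolute sum at most `(ξ + ξ)/ξ = 2`, because the mean and the variance of the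
Poisson law are both `ξ`. So `‖t A P_t f‖ ≤ 2 (1 + b/γ) ‖f‖`, which is stronger than the claim.
Each weight tends to `0` as `ξ → ∞`, so that the conditions at infinity follow from a theorem of
Toeplitz type (`tendsto_tsum_smul_zero`).
-/

noncomputable section

namespace DegDiff

/-! ### Poisson averages of a bounded sequence -/

/-- The mass `e^{-ξ} ξ^m / m!` that the Poisson law of mean `ξ` gives to `m`. It is defined for
every real `ξ`, so that it can be differentiated at `ξ = 0` as well. -/
def poissonWeight (m : ℕ) (ξ : ℝ) : ℝ := Real.exp (-ξ) * (ξ ^ m / m.factorial)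

theorem poissonWeight_nonneg (m : ℕ) {ξ : ℝ} (hξ : 0 ≤ ξ) : 0 ≤ poissonWeight m ξ := by
  unfold poissonWeight
  positivity

theorem hasSum_poissonWeight (ξ : ℝ) : HasSum (fun m => poissonWeight m ξ) 1 := by
  have h := (NormedSpace.expSeries_div_hasSum_exp ξ).mul_left (Real.exp (-ξ))
  rwa [← Real.exp_eq_exp_ℝ, ← Real.exp_add, neg_add_cancel, Real.exp_zero] at h

theorem abs_poissonWeight (m : ℕ) (ξ : ℝ) :
    |poissonWeight m ξ| = Real.exp (-ξ) * (|ξ| ^ m / m.factorial) := by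
  rw [poissonWeight, abs_mul, abs_div, abs_pow, Real.abs_exp, Nat.abs_cast]

theorem succ_mul_poissonWeight_succ (m : ℕ) (ξ : ℝ) :
    (m + 1 : ℝ) * poissonWeight (m + 1) ξ = ξ * poissonWeight m ξ := by
  simp only [poissonWeight, Nat.factorial_succ, Nat.cast_mul, Nat.cast_add, Nat.cast_one]
  field_simp
  ring

theorem tendsto_poissonWeight_mul_pow (m k : ℕ) :
    Tendsto (fun ξ => poissonWeight m ξ * ξ ^ k) atTop (𝓝 0) := by
  have h := (Real.tendsto_pow_mul_exp_neg_atTop_nhds_zero (m + k)).div_const (m.factorial : ℝ)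
  rw [zero_div] at h
  refine h.congr fun ξ => ?_
  rw [poissonWeight, pow_add]
  ring

section

variable {E : Type*} [NormedAddCommGroup E] {a : ℕ → E} {C : ℝ}

theorem norm_succ_sub_le (ha : ∀ m, ‖a m‖ ≤ C) (m : ℕ) : ‖a (m + 1) - a m‖ ≤ 2 * C := by
  linarith [norm_sub_le (a (m + 1)) (a m), ha m, ha (m + 1)]

theorem tendsto_sub_succ_zero {l : E} (ha : Tendsto a atTop (𝓝 l)) :
    Tendsto (fun m => a (m + 1) - a m) atTop (𝓝 0) := by
  simpa using (ha.comp (tendsto_add_atTop_nat 1)).sub ha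

variable [NormedSpace ℝ E]

/-- The mean of `a` under the Poisson law of mean `ξ`. -/
def poissonMean (a : ℕ → E) (ξ : ℝ) : E := ∑' m, poissonWeight m ξ • a m

theorem summable_poissonMean [CompleteSpace E] (ha : ∀ m, ‖a m‖ ≤ C) (ξ : ℝ) :
    Summable fun m => poissonWeight m ξ • a m := by
  refine Summable.of_norm_bounded
    (((Real.summable_pow_div_factorial |ξ|).mul_left (Real.exp (-ξ))).mul_right C) fun m => ?_
  rw [norm_smul, Real.norm_eq_abs, abs_poissonWeight]
  gcongr
  exact ha m

theorem hasSum_poissonMean [CompleteSpace E] (ha : ∀ m, ‖a m‖ ≤ C) (ξ : ℝ) :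
    HasSum (fun m => poissonWeight m ξ • a m) (poissonMean a ξ) :=
  (summable_poissonMean ha ξ).hasSum

theorem poissonMean_const (c : E) (ξ : ℝ) : poissonMean (fun _ => c) ξ = c := by
  simpa [poissonMean] using ((hasSum_poissonWeight ξ).smul_const c).tsum_eq

theorem norm_poissonMean_le (ha : ∀ m, ‖a m‖ ≤ C) {ξ : ℝ} (hξ : 0 ≤ ξ) :
    ‖poissonMean a ξ‖ ≤ C := by
  have h := (hasSum_poissonWeight ξ).mul_right C
  rw [one_mul] at h
  refine tsum_of_norm_bounded h fun m => ?_
  rw [norm_smul, Real.norm_of_nonneg (poissonWeight_nonneg m hξ)]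
  gcongr
  · exact poissonWeight_nonneg m hξ
  · exact ha m

theorem hasSum_exp_smul_poissonMean [CompleteSpace E] (ha : ∀ m, ‖a m‖ ≤ C) (ξ : ℝ) :
    HasSum (fun m : ℕ => (ξ ^ m / m.factorial) • a m) (Real.exp ξ • poissonMean a ξ) := by
  refine ((hasSum_poissonMean ha ξ).const_smul (Real.exp ξ)).congr_fun fun m => ?_
  rw [poissonWeight, smul_smul, ← mul_assoc, ← Real.exp_add, add_neg_cancel, Real.exp_zero,
    one_mul]

/-- An exponential power series is differentiated by shifting its coefficients. -/
theorem hasDerivAt_exp_smul_poissonMean [CompleteSpace E] (ha : ∀ m, ‖a m‖ ≤ C) (ξ : ℝ) :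
    HasDerivAt (fun η => Real.exp η • poissonMean a η)
      (Real.exp ξ • poissonMean (fun m => a (m + 1)) ξ) ξ := by
  set R : ℝ := |ξ| + 1
  have hξ : ξ ∈ Metric.ball (0 : ℝ) R := by simp [R]
  have hu : Summable fun m : ℕ => ((m : ℝ) * R ^ (m - 1) / (m.factorial : ℝ)) * C := by
    refine Summable.mul_right C ((summable_nat_add_iff 1).1 ?_)
    refine (Real.summable_pow_div_factorial R).congr fun m => ?_
    rw [Nat.factorial_succ, Nat.cast_mul, add_tsub_cancel_right,
      mul_div_mul_left _ _ (by positivity)]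
  have hterm (m : ℕ) (η : ℝ) : HasDerivAt (fun η : ℝ => (η ^ m / (m.factorial : ℝ)) • a m)
      (((m : ℝ) * η ^ (m - 1) / (m.factorial : ℝ)) • a m) η :=
    ((hasDerivAt_pow m η).div_const _).smul_const (a m)
  have hbound (m : ℕ) (η : ℝ) (hη : η ∈ Metric.ball (0 : ℝ) R) :
      ‖((m : ℝ) * η ^ (m - 1) / (m.factorial : ℝ)) • a m‖
        ≤ ((m : ℝ) * R ^ (m - 1) / (m.factorial : ℝ)) * C := by
    have hη' : |η| ≤ R := (mem_ball_zero_iff.1 hη).le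
    rw [norm_smul, Real.norm_eq_abs, abs_div, abs_mul, abs_pow, Nat.abs_cast, Nat.abs_cast]
    have h1 : (m : ℝ) * |η| ^ (m - 1) / (m.factorial : ℝ)
        ≤ (m : ℝ) * R ^ (m - 1) / (m.factorial : ℝ) := by gcongr
    exact mul_le_mul h1 (ha m) (norm_nonneg _) (by positivity)
  have hder := hasDerivAt_tsum_of_isPreconnected hu Metric.isOpen_ball
    (convex_ball (0 : ℝ) R).isPreconnected (fun m η _ => hterm m η) hbound hξ
    (hasSum_exp_smul_poissonMean ha ξ).summable hξ
  have hshift : HasSum (fun m : ℕ => ((m : ℝ) * ξ ^ (m - 1) / (m.factorial : ℝ)) • a m)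
      (Real.exp ξ • poissonMean (fun m => a (m + 1)) ξ) := by
    have h2 : HasSum (fun m : ℕ => (((m + 1 : ℕ) : ℝ) * ξ ^ (m + 1 - 1) / ((m + 1).factorial : ℝ))
        • a (m + 1)) (Real.exp ξ • poissonMean (fun m => a (m + 1)) ξ) := by
      refine (hasSum_exp_smul_poissonMean (fun m => ha (m + 1)) ξ).congr_fun fun m => ?_
      rw [Nat.factorial_succ, add_tsub_cancel_right, Nat.cast_mul,
        mul_div_mul_left _ _ (by positivity)]
    simpa using HasSum.zero_add
      (f := fun m : ℕ => ((m : ℝ) * ξ ^ (m - 1) / (m.factorial : ℝ)) • a m) h2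
  rw [hshift.tsum_eq] at hder
  exact hder.congr_of_eventuallyEq
    (Eventually.of_forall fun η => (hasSum_exp_smul_poissonMean ha η).tsum_eq.symm)

/-- The derivative of a Poisson mean is the Poisson mean of the forward differences. -/
theorem hasDerivAt_poissonMean [CompleteSpace E] (ha : ∀ m, ‖a m‖ ≤ C) (ξ : ℝ) :
    HasDerivAt (poissonMean a) (poissonMean (fun m => a (m + 1) - a m) ξ) ξ := by
  have hexp : HasDerivAt (fun η : ℝ => Real.exp (-η)) (-Real.exp (-ξ)) ξ := by
    simpa using (hasDerivAt_neg ξ).exp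
  have hdiff : poissonMean (fun m => a (m + 1) - a m) ξ
      = poissonMean (fun m => a (m + 1)) ξ - poissonMean a ξ := by
    refine HasSum.tsum_eq (((hasSum_poissonMean (fun m => ha (m + 1)) ξ).sub
      (hasSum_poissonMean ha ξ)).congr_fun fun m => ?_)
    rw [smul_sub]
  have hcancel (η : ℝ) (x : E) : Real.exp (-η) • Real.exp η • x = x := by
    rw [smul_smul, ← Real.exp_add, neg_add_cancel, Real.exp_zero, one_smul]
  have key := hexp.smul (hasDerivAt_exp_smul_poissonMean ha ξ)
  rw [hcancel, neg_smul, hcancel, ← sub_eq_add_neg, ← hdiff] at key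
  exact key.congr_of_eventuallyEq (Eventually.of_forall fun η => (hcancel η _).symm)

theorem deriv_poissonMean [CompleteSpace E] (ha : ∀ m, ‖a m‖ ≤ C) :
    deriv (poissonMean a) = poissonMean fun m => a (m + 1) - a m :=
  funext fun ξ => (hasDerivAt_poissonMean ha ξ).deriv

theorem contDiff_poissonMean [CompleteSpace E] (n : ℕ) (ha : ∀ m, ‖a m‖ ≤ C) : ContDiff ℝ n (poissonMean a) := by
  induction n generalizing a C with
  | zero =>
    exact contDiff_zero.2
      (continuous_iff_continuousAt.2 fun ξ => (hasDerivAt_poissonMean ha ξ).continuousAt)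
  | succ n ih =>
    rw [Nat.cast_succ, contDiff_succ_iff_deriv]
    refine ⟨fun ξ => (hasDerivAt_poissonMean ha ξ).differentiableAt, fun h => ?_, ?_⟩
    · exact absurd h (WithTop.coe_ne_top (α := ℕ∞) (a := n))
    · rw [deriv_poissonMean ha]
      exact ih (norm_succ_sub_le ha)

/-! ### The second derivative with its degenerate weight -/

/-- Moving a shift of the sequence onto the Poisson weights, by
`ξ · poissonWeight m ξ = (m + 1) · poissonWeight (m + 1) ξ`. -/
theorem hasSum_poissonWeight_of_shift {c : ℕ → E} {S : E} {ξ : ℝ}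
    (h : HasSum (fun m => poissonWeight m ξ • c (m + 1)) S) :
    HasSum (fun m : ℕ => (poissonWeight m ξ * m) • c m) (ξ • S) := by
  have h2 : HasSum (fun m : ℕ => (poissonWeight (m + 1) ξ * ((m + 1 : ℕ) : ℝ)) • c (m + 1))
      (ξ • S) := by
    refine (h.const_smul ξ).congr_fun fun m => ?_
    rw [smul_smul, ← succ_mul_poissonWeight_succ, mul_comm]
    push_cast
    rfl
  simpa using HasSum.zero_add (f := fun m : ℕ => (poissonWeight m ξ * m) • c m) h2

/-- The weight that `ξ v''(ξ)` gives to the `m`-th term of `a`, where `v = poissonMean a`. -/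
def secondWeight (m : ℕ) (ξ : ℝ) : ℝ := poissonWeight m ξ * ((m - ξ) ^ 2 - m) / ξ

theorem hasSum_secondWeight [CompleteSpace E] (ha : ∀ m, ‖a m‖ ≤ C) {ξ : ℝ} (hξ : 0 < ξ) :
    HasSum (fun m => secondWeight m ξ • a m)
      (ξ • poissonMean (fun m => (a (m + 2) - a (m + 1)) - (a (m + 1) - a m)) ξ) := by
  have h0 := hasSum_poissonMean ha ξ
  have h1 := hasSum_poissonMean (fun m => ha (m + 1)) ξ
  have h2 := hasSum_poissonMean (fun m => ha (m + 2)) ξ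
  have h3 := hasSum_poissonWeight_of_shift (c := a) h1
  have h4 := hasSum_poissonWeight_of_shift (c := fun m => a (m + 1)) h2
  have h5 := hasSum_poissonWeight_of_shift (c := fun m => ((m : ℝ) - 1) • a m) (ξ := ξ)
    (S := ξ • poissonMean (fun m => a (m + 2)) ξ) (by
      refine h4.congr_fun fun m => ?_
      rw [smul_smul]
      push_cast
      rw [add_sub_cancel_right])
  have h6 := ((h5.sub (h3.const_smul (2 * ξ))).add (h0.const_smul (ξ ^ 2))).const_smul ξ⁻¹
  have hd : poissonMean (fun m => (a (m + 2) - a (m + 1)) - (a (m + 1) - a m)) ξ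
      = (poissonMean (fun m => a (m + 2)) ξ - poissonMean (fun m => a (m + 1)) ξ)
        - (poissonMean (fun m => a (m + 1)) ξ - poissonMean a ξ) := by
    refine HasSum.tsum_eq (((h2.sub h1).sub (h1.sub h0)).congr_fun fun m => ?_)
    simp only [smul_sub]
  convert h6 using 1
  · funext m
    simp only [smul_smul, ← sub_smul, ← add_smul, secondWeight]
    congr 1
    field_simp
    ring
  · rw [hd]
    simp only [smul_sub, smul_add, smul_smul]
    have e1 : ξ⁻¹ * (ξ * ξ) = ξ := by field_simp
    have e2 : ξ⁻¹ * (2 * ξ * ξ) = ξ + ξ := by field_simp; ring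
    have e3 : ξ⁻¹ * ξ ^ 2 = ξ := by field_simp
    rw [e1, e2, e3, add_smul]
    abel

/-- The absolute weights of `ξ v''(ξ)` are dominated by weights of total mass `2`, the mean and
the variance of the Poisson law being both `ξ`. -/
theorem exists_hasSum_abs_secondWeight_le {ξ : ℝ} (hξ : 0 < ξ) :
    ∃ g : ℕ → ℝ, HasSum g 2 ∧ ∀ m, |secondWeight m ξ| ≤ g m := by
  refine ⟨fun m => secondWeight m ξ + 2 * (poissonWeight m ξ * m) / ξ, ?_, fun m => ?_⟩
  · have h1 := hasSum_secondWeight (a := fun _ => (1 : ℝ)) (C := 1) (by simp) hξ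
    have h2 := hasSum_poissonWeight_of_shift (c := fun _ => (1 : ℝ))
      (by simpa using hasSum_poissonWeight ξ)
    simp only [sub_self, poissonMean_const, smul_eq_mul, mul_one, mul_zero] at h1 h2
    have h3 := h1.add ((h2.mul_left 2).div_const ξ)
    rwa [zero_add, mul_div_assoc, div_self hξ.ne', mul_one] at h3
  · have hw := poissonWeight_nonneg m hξ.le
    have e : secondWeight m ξ + 2 * (poissonWeight m ξ * m) / ξ
        = poissonWeight m ξ * ((m - ξ) ^ 2 + m) / ξ := by
      rw [secondWeight]; ring
    simp only [e]
    rw [secondWeight, abs_div, abs_mul, abs_of_nonneg hw, abs_of_pos hξ]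
    gcongr
    exact (abs_sub _ _).trans_eq (by rw [abs_of_nonneg (sq_nonneg _), Nat.abs_cast])

theorem norm_smul_poissonMean_second_le [CompleteSpace E] (ha : ∀ m, ‖a m‖ ≤ C) {ξ : ℝ} (hξ : 0 ≤ ξ) :
    ‖ξ • poissonMean (fun m => (a (m + 2) - a (m + 1)) - (a (m + 1) - a m)) ξ‖ ≤ 2 * C := by
  rcases hξ.eq_or_lt with rfl | hξ
  · simpa using (norm_nonneg _).trans (ha 0)
  obtain ⟨g, hg, hle⟩ := exists_hasSum_abs_secondWeight_le hξ
  rw [← (hasSum_secondWeight ha hξ).tsum_eq]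
  refine tsum_of_norm_bounded (hg.mul_right C) fun m => ?_
  rw [norm_smul]
  exact mul_le_mul (hle m) (ha m) (norm_nonneg _) ((abs_nonneg _).trans (hle m))

/-! ### Limits at infinity -/

/-- Toeplitz's theorem for null sequences: a family of summation weights with bounded total mass,
each of which tends to zero, carries null sequences to functions that vanish at infinity. -/
theorem tendsto_tsum_smul_zero {k : ℕ → ℝ → ℝ} {M : ℝ} (hk : ∀ m, Tendsto (k m) atTop (𝓝 0))
    (hM : ∀ᶠ ξ in atTop, ∃ g : ℕ → ℝ, HasSum g M ∧ ∀ m, |k m ξ| ≤ g m)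
    (ha : Tendsto a atTop (𝓝 0)) :
    Tendsto (fun ξ => ∑' m, k m ξ • a m) atTop (𝓝 0) := by
  obtain ⟨C, hC⟩ := (Metric.isBounded_range_of_tendsto a ha).exists_norm_le
  have hC (m : ℕ) : ‖a m‖ ≤ C := hC _ (mem_range_self m)
  rw [Metric.tendsto_nhds]
  intro ε hε
  obtain ⟨ξ₀, g₀, hg₀, hle₀⟩ := hM.exists
  have hM0 : 0 ≤ M := hg₀.nonneg fun m => (abs_nonneg _).trans (hle₀ m)
  set δ : ℝ := ε / (2 * (M + 1))
  have hδ : 0 < δ := by positivity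
  obtain ⟨N, hN⟩ := eventually_atTop.1 ((tendsto_zero_iff_norm_tendsto_zero.1 ha).eventually_le_const hδ)
  have hfin : Tendsto (fun ξ => ∑ m ∈ Finset.range N, |k m ξ| * C) atTop (𝓝 0) := by
    simpa using tendsto_finsetSum (Finset.range N) fun m _ => ((hk m).abs.mul_const C)
  filter_upwards [hM, hfin.eventually_lt_const (half_pos hε)] with ξ hξ hξ'
  obtain ⟨g, hg, hle⟩ := hξ
  rw [dist_zero_right]
  have h1 : HasSum (fun m => if m ∈ Finset.range N then |k m ξ| * C else 0)
      (∑ m ∈ Finset.range N, |k m ξ| * C) := by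
    rw [← Finset.sum_congr rfl fun m (hm : m ∈ Finset.range N) => if_pos hm]
    exact hasSum_sum_of_ne_finset_zero fun m hm => if_neg hm
  have h2 := h1.add (hg.mul_right δ)
  have h3 : ‖∑' m, k m ξ • a m‖ ≤ (∑ m ∈ Finset.range N, |k m ξ| * C) + M * δ := by
    refine tsum_of_norm_bounded h2 fun m => ?_
    have hgm : 0 ≤ g m := (abs_nonneg _).trans (hle m)
    rw [norm_smul, Real.norm_eq_abs]
    split_ifs with hm
    · have := mul_le_mul_of_nonneg_left (hC m) (abs_nonneg (k m ξ))
      have := mul_nonneg hgm hδ.le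
      linarith
    · rw [zero_add]
      exact mul_le_mul (hle m) (hN m (by simpa using hm)) (norm_nonneg _) hgm
  have h4 : M * δ ≤ ε / 2 := by
    have : (M + 1) * δ = ε / 2 := by simp only [δ]; field_simp
    nlinarith
  linarith

theorem tendsto_poissonMean_zero (ha : Tendsto a atTop (𝓝 0)) :
    Tendsto (poissonMean a) atTop (𝓝 0) := by
  refine tendsto_tsum_smul_zero (M := 1) (fun m => ?_) ?_ ha
  · simpa using tendsto_poissonWeight_mul_pow m 0
  · filter_upwards [eventually_ge_atTop 0] with ξ hξ
    exact ⟨_, hasSum_poissonWeight ξ, fun m => (abs_of_nonneg (poissonWeight_nonneg m hξ)).le⟩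

theorem tendsto_poissonMean [CompleteSpace E] {l : E} (ha : Tendsto a atTop (𝓝 l)) :
    Tendsto (poissonMean a) atTop (𝓝 l) := by
  obtain ⟨C, hC⟩ := (Metric.isBounded_range_of_tendsto a ha).exists_norm_le
  have h := (tendsto_poissonMean_zero (a := fun m => a m - l)
    (by simpa using ha.sub_const l)).add_const l
  rw [zero_add] at h
  refine h.congr fun ξ => ?_
  have h1 := (hasSum_poissonMean (fun m => hC _ (mem_range_self m)) ξ).sub
    ((hasSum_poissonWeight ξ).smul_const l)
  simp only [← smul_sub, one_smul] at h1
  rw [poissonMean, h1.tsum_eq, sub_add_cancel]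

theorem tendsto_smul_poissonMean_second [CompleteSpace E] {l : E} (ha : Tendsto a atTop (𝓝 l)) :
    Tendsto (fun ξ : ℝ =>
      ξ • poissonMean (fun m => (a (m + 2) - a (m + 1)) - (a (m + 1) - a m)) ξ) atTop (𝓝 0) := by
  -- second differences do not see the limit `l`
  have h0 : Tendsto (fun m => a m - l) atTop (𝓝 0) := by simpa using ha.sub_const l
  obtain ⟨C, hC⟩ := (Metric.isBounded_range_of_tendsto _ h0).exists_norm_le
  have h1 : Tendsto (fun ξ => ∑' m, secondWeight m ξ • (a m - l)) atTop (𝓝 0) := by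
    refine tendsto_tsum_smul_zero (M := 2) (fun m => ?_) ?_ h0
    · have h2 := (((tendsto_poissonWeight_mul_pow m 0).mul_const ((m : ℝ) ^ 2 - m)).mul
        tendsto_inv_atTop_zero).add (((tendsto_poissonWeight_mul_pow m 0).mul_const (2 * (m : ℝ))).neg.add
        (tendsto_poissonWeight_mul_pow m 1))
      simp only [zero_mul, neg_zero, add_zero] at h2
      refine h2.congr' ?_
      filter_upwards [eventually_gt_atTop 0] with ξ hξ
      rw [secondWeight]
      field_simp
      ring
    · filter_upwards [eventually_gt_atTop 0] with ξ hξ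
      exact exists_hasSum_abs_secondWeight_le hξ
  refine h1.congr' ?_
  filter_upwards [eventually_gt_atTop 0] with ξ hξ
  rw [(hasSum_secondWeight (fun m => hC _ (mem_range_self m)) hξ).tsum_eq]
  simp only [sub_sub_sub_cancel_right]

end

/-! ### Gamma laws of large shape -/

open ProbabilityTheory in
/-- A gamma law of shape `a` charges `]-∞, K]` with mass at most `K r / (a - 1)`: this is Markov's
inequality for the reciprocal, whose mean is `r / (a - 1)`. -/
theorem gammaMeasure_Iic_le {a r K : ℝ} (ha : 1 < a) (hr : 0 < r) :
    gammaMeasure a r (Iic K) ≤ ENNReal.ofReal (K * r / (a - 1)) := by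
  have ha1 : 0 < a - 1 := by linarith
  have hpt (z : ℝ) (hz : z ∈ Iic K) :
      gammaPDF a r z ≤ ENNReal.ofReal (K * r / (a - 1)) * gammaPDF (a - 1) r z := by
    have hz : z ≤ K := hz
    rcases lt_trichotomy z 0 with hz0 | rfl | hz0
    · simp [gammaPDF_of_neg hz0]
    · simp [gammaPDF_of_nonneg le_rfl, Real.zero_rpow ha1.ne']
    · have hK : 0 ≤ K := hz0.le.trans hz
      rw [gammaPDF_of_nonneg hz0.le, gammaPDF_of_nonneg hz0.le, ← ENNReal.ofReal_mul (by positivity)]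
      refine ENNReal.ofReal_le_ofReal ?_
      have hG : Real.Gamma a = (a - 1) * Real.Gamma (a - 1) := by
        rw [← Real.Gamma_add_one ha1.ne', sub_add_cancel]
      have hG1 := Real.Gamma_pos_of_pos ha1
      have e1 : r ^ a = r ^ (a - 1) * r := by
        rw [← Real.rpow_add_one hr.ne', sub_add_cancel]
      have e2 : z ^ (a - 1) = z ^ (a - 1 - 1) * z := by
        rw [← Real.rpow_add_one hz0.ne', sub_add_cancel]
      calc r ^ a / Real.Gamma a * z ^ (a - 1) * Real.exp (-(r * z))
          = z * r / (a - 1) * (r ^ (a - 1) / Real.Gamma (a - 1) * z ^ (a - 1 - 1)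
              * Real.exp (-(r * z))) := by
            rw [hG, e1, e2]; field_simp
        _ ≤ _ := by gcongr
  rw [gammaMeasure, withDensity_apply _ measurableSet_Iic]
  calc ∫⁻ z in Iic K, gammaPDF a r z
      ≤ ∫⁻ z in Iic K, ENNReal.ofReal (K * r / (a - 1)) * gammaPDF (a - 1) r z :=
        setLIntegral_mono' measurableSet_Iic hpt
    _ ≤ ∫⁻ z, ENNReal.ofReal (K * r / (a - 1)) * gammaPDF (a - 1) r z := setLIntegral_le_lintegral _ _
    _ = ENNReal.ofReal (K * r / (a - 1)) := by
        rw [lintegral_const_mul' _ _ ENNReal.ofReal_ne_top, lintegral_gammaPDF_eq_one ha1 hr, mul_one]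

open ProbabilityTheory in
theorem gammaMeasure_eq_restrict (a r : ℝ) :
    gammaMeasure a r = (volume.restrict (Ioi 0)).withDensity (gammaPDF a r) := by
  rw [restrict_Ioi_eq_restrict_Ici, ← withDensity_indicator measurableSet_Ici, gammaMeasure]
  congr 1
  funext y
  by_cases hy : 0 ≤ y
  · rw [indicator_of_mem (mem_Ici.2 hy)]
  · rw [indicator_of_notMem (by simpa using hy), gammaPDF_of_neg (not_le.1 hy)]

/-- The gamma law of shape `m + β` and rate `r`, where the law of shape `0` is understood as the
point mass at `0`. -/
def gammaLaw (β r : ℝ) (m : ℕ) : Measure ℝ :=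
  if (m : ℝ) + β = 0 then Measure.dirac 0 else ProbabilityTheory.gammaMeasure (m + β) r

theorem isProbabilityMeasure_gammaLaw {β r : ℝ} (hβ : 0 ≤ β) (hr : 0 < r) (m : ℕ) :
    IsProbabilityMeasure (gammaLaw β r m) := by
  unfold gammaLaw
  split_ifs with h
  · infer_instance
  · exact ProbabilityTheory.isProbabilityMeasure_gammaMeasure
      (lt_of_le_of_ne (by positivity) (Ne.symm h)) hr

theorem tendsto_gammaLaw_Iic {β r : ℝ} (hβ : 0 ≤ β) (hr : 0 < r) (K : ℝ) :
    Tendsto (fun m => (gammaLaw β r m).real (Iic K)) atTop (𝓝 0) := by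
  have h1 : Tendsto (fun m : ℕ => ENNReal.ofReal (K * r / (m + β - 1))) atTop (𝓝 0) := by
    rw [← ENNReal.ofReal_zero]
    refine ENNReal.tendsto_ofReal (Tendsto.const_div_atTop ?_ _)
    simp only [add_sub_assoc]
    exact tendsto_atTop_add_const_right _ _ tendsto_natCast_atTop_atTop
  have h2 : Tendsto (fun m => gammaLaw β r m (Iic K)) atTop (𝓝 0) := by
    refine tendsto_of_tendsto_of_tendsto_of_le_of_le' tendsto_const_nhds h1
      (Eventually.of_forall fun _ => zero_le) ?_
    filter_upwards [eventually_ge_atTop 2] with m hm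
    have hm' : (2 : ℝ) ≤ m := by exact_mod_cast hm
    rw [gammaLaw, if_neg (by positivity)]
    exact gammaMeasure_Iic_le (by linarith) hr
  exact (ENNReal.tendsto_toReal ENNReal.zero_ne_top).comp h2

variable {𝕜 : Type*} [RCLike 𝕜]

theorem continuous_toLine (f : ℝ≥0 →ᵇ 𝕜) : Continuous (toLine f) :=
  f.continuous.comp continuous_real_toNNReal

theorem norm_toLine_le (f : ℝ≥0 →ᵇ 𝕜) (y : ℝ) : ‖toLine f y‖ ≤ ‖f‖ := f.norm_coe_le_norm _

theorem integrable_toLine (f : ℝ≥0 →ᵇ 𝕜) (μ : Measure ℝ) [IsFiniteMeasure μ] :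
    Integrable (toLine f) μ :=
  Integrable.of_bound (continuous_toLine f).aestronglyMeasurable ‖f‖
    (Eventually.of_forall (norm_toLine_le f))

theorem norm_integral_toLine_le (f : ℝ≥0 →ᵇ 𝕜) (μ : Measure ℝ) [IsProbabilityMeasure μ] :
    ‖∫ y, toLine f y ∂μ‖ ≤ ‖f‖ := by
  simpa using norm_integral_le_of_norm_le_const (μ := μ) (Eventually.of_forall (norm_toLine_le f))

/-- Probability measures whose mass escapes to `+∞` integrate `f` to values that tend to the limit
of `f` at infinity. -/
theorem tendsto_integral_toLine (f : ℝ≥0 →ᵇ 𝕜) {l : 𝕜} (hl : Tendsto f atTop (𝓝 l))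
    (μ : ℕ → Measure ℝ) [∀ m, IsProbabilityMeasure (μ m)]
    (hμ : ∀ K, Tendsto (fun m => (μ m).real (Iic K)) atTop (𝓝 0)) :
    Tendsto (fun m => ∫ y, toLine f y ∂(μ m)) atTop (𝓝 l) := by
  rw [Metric.tendsto_nhds]
  intro ε hε
  have hl' : Tendsto (toLine f) atTop (𝓝 l) := hl.comp tendsto_real_toNNReal_atTop
  obtain ⟨K, hK⟩ := eventually_atTop.1 (Metric.tendsto_nhds.1 hl' (ε / 2) (half_pos hε))
  have h1 := (hμ K).const_mul (‖f‖ + ‖l‖)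
  rw [mul_zero] at h1
  filter_upwards [h1.eventually_lt_const (half_pos hε)] with m hm
  have h2 : (∫ y, toLine f y ∂(μ m)) - l = ∫ y, (toLine f y - l) ∂(μ m) := by
    rw [integral_sub (integrable_toLine f _) (integrable_const _)]
    simp
  have hint : Integrable ((Iic K).indicator fun _ => ‖f‖ + ‖l‖) (μ m) :=
    (integrable_const _).indicator measurableSet_Iic
  have h3 : ‖∫ y, (toLine f y - l) ∂(μ m)‖
      ≤ ∫ y, (ε / 2 + (Iic K).indicator (fun _ => ‖f‖ + ‖l‖) y) ∂(μ m) := by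
    refine norm_integral_le_of_norm_le ((integrable_const _).add hint)
      (Eventually.of_forall fun y => ?_)
    by_cases hy : y ≤ K
    · rw [indicator_of_mem (mem_Iic.2 hy)]
      linarith [norm_sub_le (toLine f y) l, norm_toLine_le f y]
    · rw [indicator_of_notMem (by simpa using hy), add_zero, ← dist_eq_norm]
      exact (hK y (not_le.1 hy).le).le
  rw [integral_add (integrable_const _) hint, integral_indicator_const _ measurableSet_Iic] at h3
  simp only [integral_const, probReal_univ, smul_eq_mul, one_mul] at h3
  rw [dist_eq_norm, h2]
  linarith

/-! ### The kernel as a Poisson mixture of gamma laws -/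

open ProbabilityTheory in
/-- A density on `]0,∞[` that is a mixture `∑ c m · gammaPDF (α m) r` of gamma densities defines the
mixture of the gamma laws. -/
theorem withDensity_eq_sum_gammaMeasure {c α : ℕ → ℝ} {r : ℝ} {g : ℝ → ℝ} (hc : ∀ m, 0 ≤ c m)
    (hα : ∀ m, 0 < α m) (hr : 0 < r)
    (hg : ∀ y, 0 < y → HasSum (fun m => c m * gammaPDFReal (α m) r y) (g y)) :
    ((volume.restrict (Ioi 0)).withDensity fun y => ENNReal.ofReal (g y))
      = Measure.sum fun m => ENNReal.ofReal (c m) • gammaMeasure (α m) r := by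
  have hmeas (m : ℕ) : Measurable (gammaPDF (α m) r) :=
    (measurable_gammaPDFReal (α m) r).ennreal_ofReal
  have h1 : (fun y => ENNReal.ofReal (g y)) =ᵐ[volume.restrict (Ioi 0)]
      ∑' m, ENNReal.ofReal (c m) • gammaPDF (α m) r := by
    filter_upwards [ae_restrict_mem measurableSet_Ioi] with y hy
    have hy := hg y hy
    rw [← hy.tsum_eq, ENNReal.ofReal_tsum_of_nonneg
      (fun m => mul_nonneg (hc m) (gammaPDFReal_nonneg (hα m) hr y)) hy.summable, ENNReal.tsum_apply]
    simp only [Pi.smul_apply, smul_eq_mul, gammaPDF, ENNReal.ofReal_mul (hc _)]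
  rw [withDensity_congr_ae h1, withDensity_tsum fun m => (hmeas m).const_smul _]
  congr 1
  funext m
  rw [withDensity_smul _ (hmeas m), gammaMeasure_eq_restrict]

theorem summable_div_factorial_mul_Gamma {β : ℝ} (hβ : 0 ≤ β) (z : ℝ) :
    Summable fun m : ℕ => z ^ m / ((m.factorial : ℝ) * Real.Gamma (m + β)) := by
  refine Summable.of_norm_bounded_eventually_nat (Real.summable_pow_div_factorial |z|) ?_
  filter_upwards [eventually_ge_atTop 2] with m hm
  have hm' : (2 : ℝ) ≤ m := by exact_mod_cast hm
  -- the gamma function is increasing on `[2,∞[`, where it is at least `Γ 2 = 1`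
  have hG : 1 ≤ Real.Gamma (m + β) := by
    rw [← Real.Gamma_two]
    exact Real.Gamma_strictMonoOn_Ici.monotoneOn self_mem_Ici (mem_Ici.2 (by linarith))
      (by linarith)
  have hf : (0 : ℝ) < m.factorial := by positivity
  rw [norm_div, norm_pow, Real.norm_eq_abs, Real.norm_of_nonneg (by positivity)]
  gcongr
  nlinarith

open ProbabilityTheory in
theorem hasSum_kernelPos {γ b t x : ℝ} (hγ : 0 < γ) (hb : 0 < b) (ht : 0 < t) {y : ℝ} (hy : 0 < y) :
    HasSum (fun m : ℕ => poissonWeight m (x / (γ * t)) * gammaPDFReal (m + b / γ) (γ * t)⁻¹ y)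
      (kernelPos γ b x y t) := by
  have hs : 0 < γ * t := by positivity
  have hβ : 0 < b / γ := by positivity
  have h := (summable_div_factorial_mul_Gamma hβ.le (x * y / (γ * t) ^ 2)).hasSum.mul_left
    ((γ * t) ^ (-(b / γ)) * Real.exp (-((x + y) / (γ * t))) * y ^ (b / γ - 1))
  have e (m : ℕ) : (x * y / (γ * t) ^ 2) ^ m / ((m.factorial : ℝ) * Real.Gamma (m + b / γ))
      = 1 / ((m.factorial : ℝ) * Real.Gamma (m + b / γ)) *
        (x ^ m * y ^ m / (γ ^ (2 * m) * t ^ (2 * m))) := by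
    rw [div_pow, mul_pow, ← pow_mul, mul_pow, one_div_mul_eq_div]
  simp only [e] at h
  refine h.congr_fun fun m => ?_
  have hG : 0 < Real.Gamma (m + b / γ) := Real.Gamma_pos_of_pos (by positivity)
  have e1 : (γ * t)⁻¹ ^ ((m : ℝ) + b / γ) = (γ * t) ^ (-(b / γ)) / (γ * t) ^ m := by
    rw [Real.inv_rpow hs.le, Real.rpow_add hs, Real.rpow_natCast, Real.rpow_neg hs.le]
    field_simp
  have e2 : y ^ ((m : ℝ) + b / γ - 1) = y ^ m * y ^ (b / γ - 1) := by
    rw [add_sub_assoc, Real.rpow_add hy, Real.rpow_natCast]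
  have e3 : Real.exp (-((x + y) / (γ * t)))
      = Real.exp (-(x / (γ * t))) * Real.exp (-((γ * t)⁻¹ * y)) := by
    rw [← Real.exp_add]; congr 1; field_simp; ring
  have hs' : (γ * t) ^ (2 * m) = (γ * t) ^ m * (γ * t) ^ m := by ring
  rw [gammaPDFReal, if_pos hy.le, poissonWeight, e1, e2, e3, ← mul_pow γ t, hs', div_pow]
  field_simp

open ProbabilityTheory in
theorem hasSum_kernelZero {γ t x : ℝ} (hγ : 0 < γ) (ht : 0 < t) {y : ℝ} (hy : 0 < y) :
    HasSum (fun m : ℕ => poissonWeight (m + 1) (x / (γ * t)) * gammaPDFReal (m + 1) (γ * t)⁻¹ y)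
      (kernelZero γ x y t) := by
  have hs : 0 < γ * t := by positivity
  have h := ((summable_nat_add_iff 1).2
    (summable_div_factorial_mul_Gamma le_rfl (x * y / (γ * t) ^ 2))).hasSum.mul_left
    ((γ * t)⁻¹ * Real.exp (-((x + y) / (γ * t))) * ((γ * t) / y))
  have hG (m : ℕ) : Real.Gamma (m + 1) = m.factorial := Real.Gamma_nat_eq_factorial m
  rw [← tsum_mul_left] at h
  have e (m : ℕ) : (γ * t)⁻¹ * Real.exp (-((x + y) / (γ * t))) * ((γ * t) / y) *
        ((x * y / (γ * t) ^ 2) ^ (m + 1)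
          / (((m + 1).factorial : ℝ) * Real.Gamma ((m + 1 : ℕ) + 0)))
      = (γ * t)⁻¹ * Real.exp (-((x + y) / (γ * t))) *
        (1 / (((m + 1).factorial : ℝ) * (m.factorial : ℝ)) *
          (x ^ (m + 1) * y ^ m / (γ ^ (2 * m + 1) * t ^ (2 * m + 1)))) := by
    have e0 : ((γ * t) ^ 2) ^ (m + 1) = γ ^ (2 * m + 1) * t ^ (2 * m + 1) * (γ * t) := by ring
    rw [add_zero, Nat.cast_succ, hG, div_pow, mul_pow x y, e0, pow_succ y]
    field_simp
  simp only [e] at h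
  rw [tsum_mul_left] at h
  refine h.congr_fun fun m => ?_
  have e1 : (γ * t)⁻¹ ^ ((m : ℝ) + 1) = ((γ * t) ^ (m + 1))⁻¹ := by
    rw [← Nat.cast_succ, Real.rpow_natCast, inv_pow]
  have e2 : y ^ ((m : ℝ) + 1 - 1) = y ^ m := by
    rw [add_sub_cancel_right, Real.rpow_natCast]
  have e3 : Real.exp (-((x + y) / (γ * t)))
      = Real.exp (-(x / (γ * t))) * Real.exp (-((γ * t)⁻¹ * y)) := by
    rw [← Real.exp_add]; congr 1; field_simp; ring
  have e4 : γ ^ (2 * m + 1) * t ^ (2 * m + 1) * (γ * t) = (γ * t) ^ (m + 1) * (γ * t) ^ (m + 1) := by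
    ring
  rw [gammaPDFReal, if_pos hy.le, poissonWeight, e1, e2, e3, hG, div_pow, eq_comm]
  calc _ = Real.exp (-(x / (γ * t))) * Real.exp (-((γ * t)⁻¹ * y)) * (x ^ (m + 1) * y ^ m)
        / (((m + 1).factorial : ℝ) * m.factorial)
        * (γ ^ (2 * m + 1) * t ^ (2 * m + 1) * (γ * t))⁻¹ := by field_simp
    _ = _ := by rw [e4]; field_simp

/-- The kernel with parameter `x` is the mixture of the gamma laws of shape `m + b/γ` and scale
`γ t` whose index `m` follows the Poisson law of mean `x/(γ t)`. For `b = 0` the point mass of the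
kernel is the term `m = 0`. -/
theorem kernelMeasure_eq_sum {γ b t x : ℝ} (hγ : 0 < γ) (hb : 0 ≤ b) (ht : 0 < t) (hx : 0 ≤ x) :
    kernelMeasure γ b t x = Measure.sum fun m =>
      ENNReal.ofReal (poissonWeight m (x / (γ * t))) • gammaLaw (b / γ) (γ * t)⁻¹ m := by
  have hs : 0 < γ * t := by positivity
  have hξ : 0 ≤ x / (γ * t) := by positivity
  rcases hb.eq_or_lt with rfl | hb
  · rw [kernelMeasure, if_pos rfl, withDensity_eq_sum_gammaMeasure
      (c := fun m => poissonWeight (m + 1) (x / (γ * t))) (α := fun m => (m : ℝ) + 1)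
      (fun m => poissonWeight_nonneg (m + 1) hξ) (fun m => m.cast_add_one_pos) (inv_pos.2 hs)
      fun y hy => hasSum_kernelZero hγ ht hy]
    ext S hS
    rw [Measure.add_apply, Measure.sum_apply _ hS, Measure.sum_apply _ hS]
    conv_rhs => rw [tsum_eq_zero_add' ENNReal.summable]
    have h0 : gammaLaw (0 / γ) (γ * t)⁻¹ 0 = Measure.dirac 0 := by
      rw [gammaLaw, if_pos (by simp)]
    have hsucc (m : ℕ) : gammaLaw (0 / γ) (γ * t)⁻¹ (m + 1)
        = ProbabilityTheory.gammaMeasure (m + 1) (γ * t)⁻¹ := by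
      rw [gammaLaw, zero_div, add_zero, Nat.cast_succ, if_neg m.cast_add_one_pos.ne']
    have hw : poissonWeight 0 (x / (γ * t)) = Real.exp (-(x / (γ * t))) := by simp [poissonWeight]
    simp only [h0, hsucc, hw]
  · have hβ : 0 < b / γ := by positivity
    rw [kernelMeasure, if_neg hb.ne', withDensity_eq_sum_gammaMeasure
      (c := fun m => poissonWeight m (x / (γ * t))) (α := fun m => (m : ℝ) + b / γ)
      (fun m => poissonWeight_nonneg m hξ) (fun m => by positivity) (inv_pos.2 hs)
      fun y hy => hasSum_kernelPos hγ hb ht hy]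
    congr 1
    funext m
    rw [gammaLaw, if_neg (by positivity)]

theorem isProbabilityMeasure_kernelMeasure {γ b t x : ℝ} (hγ : 0 < γ) (hb : 0 ≤ b) (ht : 0 < t)
    (hx : 0 ≤ x) : IsProbabilityMeasure (kernelMeasure γ b t x) := by
  have hs : 0 < γ * t := by positivity
  have hξ : 0 ≤ x / (γ * t) := by positivity
  have hβ : 0 ≤ b / γ := by positivity
  constructor
  rw [kernelMeasure_eq_sum hγ hb ht hx, Measure.sum_apply _ MeasurableSet.univ]
  have h (m : ℕ) : (gammaLaw (b / γ) (γ * t)⁻¹ m) univ = 1 :=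
    (isProbabilityMeasure_gammaLaw hβ (inv_pos.2 hs) m).measure_univ
  simp only [Measure.smul_apply, h, smul_eq_mul, mul_one]
  rw [← ENNReal.ofReal_tsum_of_nonneg (fun m => poissonWeight_nonneg m hξ)
    (hasSum_poissonWeight _).summable, (hasSum_poissonWeight _).tsum_eq, ENNReal.ofReal_one]

theorem toLine_eqOn {E : Type*} {u : ℝ≥0 → E} {v : ℝ → E} {s : ℝ} (hu : ∀ x : ℝ≥0, u x = v (x / s)) :
    EqOn (toLine u) (fun x => v (x / s)) (Ici 0) := fun y hy => by
  simp only [toLine, hu, Real.coe_toNNReal y hy]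

/-- The mean of `f` under the gamma law of shape `m + β` and rate `r`. -/
def gammaMean (β r : ℝ) (f : ℝ≥0 → 𝕜) (m : ℕ) : 𝕜 := ∫ y, toLine f y ∂(gammaLaw β r m)

theorem norm_gammaMean_le {β r : ℝ} (hβ : 0 ≤ β) (hr : 0 < r) (f : ℝ≥0 →ᵇ 𝕜) (m : ℕ) :
    ‖gammaMean β r f m‖ ≤ ‖f‖ :=
  have := isProbabilityMeasure_gammaLaw hβ hr m
  norm_integral_toLine_le f _

theorem tendsto_gammaMean {β r : ℝ} (hβ : 0 ≤ β) (hr : 0 < r) (f : ℝ≥0 →ᵇ 𝕜) {l : 𝕜}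
    (hl : Tendsto f atTop (𝓝 l)) : Tendsto (gammaMean β r f) atTop (𝓝 l) :=
  have := isProbabilityMeasure_gammaLaw hβ hr
  tendsto_integral_toLine f hl _ (tendsto_gammaLaw_Iic hβ hr)

theorem P_eq_poissonMean {γ b t : ℝ} (hγ : 0 < γ) (hb : 0 ≤ b) (ht : 0 < t) (f : ℝ≥0 →ᵇ 𝕜)
    (x : ℝ≥0) : P γ b t f x = poissonMean (gammaMean (b / γ) (γ * t)⁻¹ f) (x / (γ * t)) := by
  have hξ : 0 ≤ (x : ℝ) / (γ * t) := by positivity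
  have := isProbabilityMeasure_kernelMeasure hγ hb ht x.coe_nonneg
  have hint := integrable_toLine f (kernelMeasure γ b t x)
  rw [P, if_neg ht.ne']
  rw [kernelMeasure_eq_sum hγ hb ht x.coe_nonneg] at hint ⊢
  rw [integral_sum_measure hint]
  refine tsum_congr fun m => ?_
  rw [integral_smul_measure, ENNReal.toReal_ofReal (poissonWeight_nonneg m hξ), gammaMean]

/-! ### The domain and the operator -/

/-- Derivatives of a dilated function, for a function `v` that is smooth across `0`. -/
theorem D1_eqOn {u : ℝ≥0 → 𝕜} {v : ℝ → 𝕜} {s : ℝ} (hv : Differentiable ℝ v)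
    (hu : EqOn (toLine u) (fun x => v (x / s)) (Ici 0)) :
    EqOn (D1 u) (fun x => s⁻¹ • deriv v (x / s)) (Ici 0) := by
  intro x hx
  have h : HasDerivAt (fun x => v (x / s)) (s⁻¹ • deriv v (x / s)) x := by
    have := (hv (x / s)).hasDerivAt.scomp x ((hasDerivAt_id x).div_const s)
    simpa [Function.comp_def] using this
  rw [D1, derivWithin_congr hu (hu hx)]
  exact h.hasDerivWithinAt.derivWithin (uniqueDiffOn_Ici 0 x hx)

theorem D2_eqOn {u : ℝ≥0 → 𝕜} {v : ℝ → 𝕜} {s : ℝ} (hv : Differentiable ℝ v)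
    (hv' : Differentiable ℝ (deriv v)) (hu : EqOn (toLine u) (fun x => v (x / s)) (Ici 0)) :
    EqOn (D2 u) (fun x => s⁻¹ • s⁻¹ • deriv (deriv v) (x / s)) (Ici 0) := by
  intro x hx
  have h : HasDerivAt (fun x => s⁻¹ • deriv v (x / s)) (s⁻¹ • s⁻¹ • deriv (deriv v) (x / s)) x := by
    have h1 : HasDerivAt (fun x => deriv v (x / s)) (s⁻¹ • deriv (deriv v) (x / s)) x := by
      have := (hv' (x / s)).hasDerivAt.scomp x ((hasDerivAt_id x).div_const s)
      simpa [Function.comp_def] using this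
    exact h1.const_smul s⁻¹
  have hD := D1_eqOn hv hu
  rw [D2, derivWithin_congr hD (hD hx)]
  exact h.hasDerivWithinAt.derivWithin (uniqueDiffOn_Ici 0 x hx)

section dilation

variable {γ b t C : ℝ} {a : ℕ → 𝕜} {u : ℝ≥0 → 𝕜}

theorem differentiable_poissonMean (ha : ∀ m, ‖a m‖ ≤ C) : Differentiable ℝ (poissonMean a) :=
  fun ξ => (hasDerivAt_poissonMean ha ξ).differentiableAt

/-- On dilated Poisson means, `t A^{γ,b}` acts in the variable `ξ = x/(γ t)` as
`ξ v'' + (b/γ) v'`. -/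
theorem smul_diffExpr_eq (hγ : 0 < γ) (ht : 0 < t) (ha : ∀ m, ‖a m‖ ≤ C)
    (hu : ∀ x : ℝ≥0, u x = poissonMean a (x / (γ * t))) {x : ℝ} (hx : 0 ≤ x) :
    t • diffExpr γ b u x
      = (x / (γ * t)) • poissonMean (fun m => (a (m + 2) - a (m + 1)) - (a (m + 1) - a m))
          (x / (γ * t))
        + (b / γ) • poissonMean (fun m => a (m + 1) - a m) (x / (γ * t)) := by
  have hs := toLine_eqOn hu
  have hd1 := deriv_poissonMean ha
  have hd2 := deriv_poissonMean (norm_succ_sub_le ha)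
  have hv := differentiable_poissonMean ha
  have hv' : Differentiable ℝ (deriv (poissonMean a)) :=
    hd1 ▸ differentiable_poissonMean (norm_succ_sub_le ha)
  rw [diffExpr, D1_eqOn hv hs hx, D2_eqOn hv hv' hs hx, hd1, hd2]
  simp only [smul_add, smul_smul]
  congr 2
  · field_simp
  · field_simp

theorem tendsto_smul_D2_zero (ha : ∀ m, ‖a m‖ ≤ C) {s : ℝ}
    (hu : ∀ x : ℝ≥0, u x = poissonMean a (x / s)) :
    Tendsto (fun x : ℝ => x • D2 u x) (𝓝[>] 0) (𝓝 0) := by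
  have hd1 := deriv_poissonMean ha
  have hd2 := deriv_poissonMean (norm_succ_sub_le ha)
  have hv' : Differentiable ℝ (deriv (poissonMean a)) :=
    hd1 ▸ differentiable_poissonMean (norm_succ_sub_le ha)
  have hcont : Continuous (deriv (deriv (poissonMean a))) := by
    rw [hd1, hd2]
    exact (differentiable_poissonMean (norm_succ_sub_le (norm_succ_sub_le ha))).continuous
  have h : Continuous fun x : ℝ => x • s⁻¹ • s⁻¹ • deriv (deriv (poissonMean a)) (x / s) := by
    fun_prop
  have h0 := h.tendsto 0
  rw [zero_smul] at h0
  refine (h0.mono_left nhdsWithin_le_nhds).congr' ?_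
  filter_upwards [self_mem_nhdsWithin] with x hx
  rw [D2_eqOn (differentiable_poissonMean ha) hv' (toLine_eqOn hu) (Ioi_subset_Ici_self hx)]

theorem inDomain_of_eq_poissonMean {l : 𝕜} (hγ : 0 < γ) (ht : 0 < t) (ha : ∀ m, ‖a m‖ ≤ C)
    (hl : Tendsto a atTop (𝓝 l)) (hu : ∀ x : ℝ≥0, u x = poissonMean a (x / (γ * t))) :
    InDomain γ b u := by
  have hs := toLine_eqOn hu
  have hsmooth (n : ℕ) : ContDiff ℝ n (fun x : ℝ => poissonMean a (x / (γ * t))) :=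
    (contDiff_poissonMean n ha).comp (contDiff_id.div_const _)
  have hξ : Tendsto (fun x : ℝ => x / (γ * t)) atTop atTop :=
    tendsto_id.atTop_div_const (by positivity)
  refine ⟨?_, ?_, fun hb => ?_, fun _ => ?_, fun _ => tendsto_smul_D2_zero ha hu⟩
  · exact (hsmooth 2).contDiffOn.congr fun x hx => hs (Ioi_subset_Ici_self hx)
  · have h := (((tendsto_smul_poissonMean_second hl).comp hξ).add
      (((tendsto_poissonMean_zero (tendsto_sub_succ_zero hl)).comp hξ).const_smul
        (b / γ))).const_smul t⁻¹
    simp only [smul_zero, add_zero] at h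
    refine h.congr' ?_
    filter_upwards [eventually_ge_atTop 0] with x hx
    simp only [Function.comp_apply]
    rw [← smul_diffExpr_eq hγ ht ha hu hx, inv_smul_smul₀ ht.ne']
  · subst hb
    have h := (tendsto_smul_D2_zero ha hu).const_smul γ
    rw [smul_zero] at h
    refine h.congr fun x => ?_
    rw [diffExpr, zero_smul, add_zero, mul_smul]
  · exact (hsmooth 1).contDiffOn.congr hs

theorem norm_smul_diffExpr_le (hγ : 0 < γ) (hb : 0 ≤ b) (ht : 0 < t) (ha : ∀ m, ‖a m‖ ≤ C)
    (hu : ∀ x : ℝ≥0, u x = poissonMean a (x / (γ * t))) {x : ℝ} (hx : 0 ≤ x) :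
    ‖t • diffExpr γ b u x‖ ≤ 2 * (1 + b / γ) * C := by
  have hξ : 0 ≤ x / (γ * t) := by positivity
  have hβ : 0 ≤ b / γ := by positivity
  rw [smul_diffExpr_eq hγ ht ha hu hx]
  have h1 := norm_smul_poissonMean_second_le ha hξ
  have h2 : ‖(b / γ) • poissonMean (fun m => a (m + 1) - a m) (x / (γ * t))‖
      ≤ b / γ * (2 * C) := by
    rw [norm_smul, Real.norm_of_nonneg hβ]
    exact mul_le_mul_of_nonneg_left (norm_poissonMean_le (norm_succ_sub_le ha) hξ) hβ
  refine (norm_add_le_of_le h1 h2).trans_eq ?_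
  ring

end dilation

/-- `P_t^{γ,b} f` as an element of `D(A^{γ,b})`. -/
theorem exists_mem_domain_eq_P {γ b t : ℝ} (hγ : 0 < γ) (hb : 0 ≤ b) (ht : 0 < t)
    (f : CInfty 𝕜) : ∃ u : (A 𝕜 γ b).domain, ⇑(u : CInfty 𝕜).1 = P γ b t ⇑f.1 := by
  have hβ : 0 ≤ b / γ := by positivity
  have hr : 0 < (γ * t)⁻¹ := by positivity
  obtain ⟨l, hl⟩ := f.2
  have ha := norm_gammaMean_le hβ hr f.1
  have hlim := tendsto_gammaMean hβ hr f.1 hl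
  have hu := P_eq_poissonMean hγ hb ht f.1
  have hcont : Continuous (P γ b t ⇑f.1) := by
    rw [funext hu]
    exact (differentiable_poissonMean ha).continuous.comp (NNReal.continuous_coe.div_const _)
  have hatTop : Tendsto (P γ b t ⇑f.1) atTop (𝓝 l) := by
    rw [funext hu]
    exact (tendsto_poissonMean hlim).comp
      ((NNReal.tendsto_coe_atTop.2 tendsto_id).atTop_div_const (by positivity))
  obtain ⟨K, hK⟩ := exists_bound hcont hatTop
  exact ⟨⟨⟨BoundedContinuousFunction.ofNormedAddCommGroup _ hcont K hK, l, hatTop⟩,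
    inDomain_of_eq_poissonMean hγ ht ha hlim hu⟩, rfl⟩

theorem norm_smul_A_le {γ b t : ℝ} (hγ : 0 < γ) (hb : 0 ≤ b) (ht : 0 < t) (f : CInfty 𝕜)
    (u : (A 𝕜 γ b).domain) (hu : ⇑(u : CInfty 𝕜).1 = P γ b t ⇑f.1) :
    ‖(t : 𝕜) • A 𝕜 γ b u‖ ≤ 2 * (1 + b / γ) * ‖f‖ := by
  have hβ : 0 ≤ b / γ := by positivity
  have hr : 0 < (γ * t)⁻¹ := by positivity
  refine (BoundedContinuousFunction.norm_le (by positivity)).2 fun x => ?_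
  have h := norm_smul_diffExpr_le hγ hb ht (norm_gammaMean_le hβ hr f.1)
    (fun y => (congrFun hu y).trans (P_eq_poissonMean hγ hb ht f.1 y)) x.coe_nonneg
  rw [RCLike.real_smul_eq_coe_smul (K := 𝕜)] at h
  exact h

end DegDiff

end

theorem proposition4p1 {𝕜 : Type*} [RCLike 𝕜] (B γ₀ : ℝ) (hB : 0 < B) (hγ₀ : 0 < γ₀)
    (b : ℝ) (hb : b ∈ Set.Icc 0 B) (γ : ℝ) (hγ : γ₀ ≤ γ) (f : DegDiff.CInfty 𝕜)
    (t : ℝ) (ht : 0 ≤ t) :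
    (0 < t → ∃ u : (DegDiff.A 𝕜 γ b).domain, ⇑(u : DegDiff.CInfty 𝕜).1 = DegDiff.P γ b t ⇑f.1) ∧
    (∀ u : (DegDiff.A 𝕜 γ b).domain, ⇑(u : DegDiff.CInfty 𝕜).1 = DegDiff.P γ b t ⇑f.1 →
      ‖(t : 𝕜) • DegDiff.A 𝕜 γ b u‖ ≤ 2 * (1 + √2 + b / γ) * ‖f‖) ∧
    2 * (1 + √2 + b / γ) * ‖f‖ ≤ 2 * (1 + √2 + B / γ₀) * ‖f‖ := by
  have hγ' : 0 < γ := hγ₀.trans_le hγ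
  have hβ : 0 ≤ b / γ := div_nonneg hb.1 hγ'.le
  refine ⟨fun ht' => DegDiff.exists_mem_domain_eq_P hγ' hb.1 ht' f, fun u hu => ?_, ?_⟩
  · rcases ht.eq_or_lt with rfl | ht'
    · rw [RCLike.ofReal_zero, zero_smul, norm_zero]
      positivity
    · refine (DegDiff.norm_smul_A_le hγ' hb.1 ht' f u hu).trans ?_
      gcongr
      linarith [Real.sqrt_nonneg 2]
  · gcongr
    exact hb.2
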